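/- Let $C_2>0$ and $\rho\in\mathbb{R}$ be constants (for instance $\rho=\pm1$), let $L>0$, $I=[0,L]$, and set $$Z(z)=\frac{1}{2C_2}\bigl(1-e^{-2C_2z}\bigr),\qquad T(z,t)=e^{-C_2z}\,t,\qquad J=Z(I).$$ Let $Q\in C(J,H^2(\mathbb{R}))$ be a solution of the standard nonlinear Schr\"odinger equation $$iQ_Z+Q_{TT}+\rho|Q|^2Q=0 \quad\text{on } J,$$ that is, the curve $Z\mapsto Q(Z,\cdot)$ is differentiable in $L^2(\mathbb{R})$ at every point of $J$ (one-sidedly at the end points) and the equation holds in $L^2(\mathbb{R})$ for every $Z\in J$, $Q_{TT}$ being the weak second derivative. Define $$v(z,t)=e^{\,i\frac{C_2}{4}t^2-\frac{C_2}{2}z}\;Q\bigl(Z(z),T(z,t)\bigr),\qquad z\in I,\ t\in\mathbb{R}.$$ If $t^2v(0,\cdot)\in L^2(\mathbb{R})$ and $|t|\,v_t(0,\cdot)\in L^2(\mathbb{R})$, where $v_t(0,\cdot)$ is the weak derivative of $v(0,\cdot)$, then $t^2v(z,\cdot)\in L^2(\mathbb{R})$ for every $z\in I$. -/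

import Mathlib

open MeasureTheory Filter Topology Set
open scoped ENNReal

noncomputable section

namespace NLSE

/-- `g` is the weak derivative of order `α` of `f` on the real line: both functions are locally
integrable and `∫ g φ = (-1)^α ∫ f φ^(α)` for every compactly supported `φ` of class `C^α`. -/
def HasWeakDeriv (α : ℕ) (f g : ℝ → ℂ) : Prop :=
  LocallyIntegrable f volume ∧ LocallyIntegrable g volume ∧
    ∀ φ : ℝ → ℂ, ContDiff ℝ α φ → HasCompactSupport φ →
      ∫ t, g t * φ t = (-1 : ℂ) ^ α * ∫ t, f t * iteratedDeriv α φ t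

open Classical in
/-- The weak derivative of order `α` of `f` (unique up to a null set); the value is `0` if there
is none, which never happens for `α ≤ m` and `f` in the Sobolev space of order `m`. -/
def weakDeriv (α : ℕ) (f : ℝ → ℂ) : ℝ → ℂ :=
  if h : ∃ g, HasWeakDeriv α f g then h.choose else 0

/-- `f ∈ H^m(ℝ)`: the weak derivatives of orders `0, …, m` exist and are square integrable. -/
def MemSobolev (m : ℕ) (f : ℝ → ℂ) : Prop :=
  MemLp f 2 volume ∧ ∀ α ≤ m, ∃ g, HasWeakDeriv α f g ∧ MemLp g 2 volume

/-- The norm of `H^m(ℝ)`, `(∑_{α ≤ m} ‖D^α f‖_{L²}²)^(1/2)`. -/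
def sobolevNorm (m : ℕ) (f : ℝ → ℂ) : ℝ≥0∞ :=
  (∑ α ∈ Finset.range (m + 1), eLpNorm (weakDeriv α f) 2 volume ^ 2) ^ (1 / 2 : ℝ)

/-- `Q ∈ C(J, H^m(ℝ))`, where `Q Z` is the function `T ↦ Q(Z, T)`. -/
def ContinuousInSobolev (m : ℕ) (J : Set ℝ) (Q : ℝ → ℝ → ℂ) : Prop :=
  (∀ Z ∈ J, MemSobolev m (Q Z)) ∧
    ∀ Z ∈ J, Tendsto (fun Y => sobolevNorm m (Q Y - Q Z)) (𝓝[J] Z) (𝓝 0)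

/-- The curve `Z ↦ Q Z` in `L²(ℝ)` has at the point `Z`, within `J`, the derivative `R`: the
difference quotients converge to `R` in `L²(ℝ)` (one-sided at an end point of `J`). -/
def HasL2DerivWithin (Q : ℝ → ℝ → ℂ) (R : ℝ → ℂ) (J : Set ℝ) (Z : ℝ) : Prop :=
  MemLp R 2 volume ∧
    Tendsto (fun Y => eLpNorm (fun T => (Q Y T - Q Z T) / ((Y - Z : ℝ) : ℂ) - R T) 2 volume)
      (𝓝[J \ {Z}] Z) (𝓝 0)

/-- `Q ∈ C(J, H²(ℝ))` solves `i Q_Z + Q_TT + ρ |Q|² Q = 0` on `J`: the curve `Z ↦ Q(Z, ·)` is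
differentiable in `L²(ℝ)` at each point of `J`, and the equation holds in `L²(ℝ)`.
Membership in `C¹(J, L²(ℝ))` is then automatic, since the equation expresses `Q_Z` by functions
that depend continuously on `Z` in `L²(ℝ)`. -/
def IsH2Solution (ρ : ℝ) (J : Set ℝ) (Q : ℝ → ℝ → ℂ) : Prop :=
  ContinuousInSobolev 2 J Q ∧
    ∀ Z ∈ J, ∃ R : ℝ → ℂ, HasL2DerivWithin Q R J Z ∧
      ∀ᵐ T ∂volume,
        Complex.I * R T + weakDeriv 2 (Q Z) T + (ρ : ℂ) * ((‖Q Z T‖ : ℂ) ^ 2 * Q Z T) = 0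

/-- `Z(z) = (1 - e^{-2 C₂ z}) / (2 C₂)`. -/
def newZ (C₂ z : ℝ) : ℝ := 1 / (2 * C₂) * (1 - Real.exp (-2 * C₂ * z))

/-- `T(z, t) = e^{-C₂ z} t`. -/
def newT (C₂ z t : ℝ) : ℝ := Real.exp (-C₂ * z) * t

/-- `v(z, t) = e^{i C₂ t² / 4 - C₂ z / 2} Q(Z(z), T(z, t))`. -/
def transformed (C₂ : ℝ) (Q : ℝ → ℝ → ℂ) (z t : ℝ) : ℂ :=
  Complex.exp (Complex.I * (C₂ / 4 * t ^ 2) - C₂ / 2 * z) * Q (newZ C₂ z) (newT C₂ z t)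

end NLSE

end

namespace NLSE

open scoped ContDiff


/-! At fixed `z`, `|v|` is `|Q|` up to a positive factor and a dilation, so it suffices to propagate
`T²Q ∈ L²` along the standard equation.

For a compactly supported real weight `θ` with `|θ'| ≤ C`, the `Z`-derivative of `‖θ²Q‖²` is `-2 Im
∫ θ⁴ Q̄ Q_TT`: the nonlinearity contributes nothing because `ρ|Q|⁴` is real. Integration by parts
turns this into a multiple of `∫ θ³θ' Q̄ Q_T`, since `θ⁴|Q_T|²` is real too. A second integration by
parts, with weight `θ²`, controls `‖θQ_T‖²` by `‖θ²Q‖²` and the `L²` norms of `Q` and `Q_TT`, which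
are bounded on the compact `J` (`abs_im_integral_weight_le`). Grönwall then gives a bound depending
on `θ` only through `C` and the initial value (`IsH2Solution.weighted_bound`). Letting `θ` increase
to `|T|` in modulus finishes the proof by lower semicontinuity of the norm
(`IsH2Solution.memLp_sq_mul`). -/

/-! ### Weak derivatives on the line and integration by parts -/

theorem LocallyIntegrable.integrable_mul_of_hasCompactSupport {f ψ : ℝ → ℂ}
    (hf : LocallyIntegrable f volume) (hψ : Continuous ψ) (hs : HasCompactSupport ψ) :
    Integrable (fun t => f t * ψ t) volume := by
  simpa [mul_comm] using hf.integrable_smul_left_of_hasCompactSupport hψ hs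

theorem exists_tsupport_subset_Ioo {ψ : ℝ → ℂ} (hs : HasCompactSupport ψ) :
    ∃ r : ℝ, 0 < r ∧ tsupport ψ ⊆ Ioo (-r) r := by
  obtain ⟨r, hr, h⟩ := hs.isBounded.subset_ball_lt 0 (0 : ℝ)
  exact ⟨r, hr, by simpa [Real.ball_eq_Ioo] using h⟩

theorem integral_deriv_of_hasCompactSupport {ψ : ℝ → ℂ} (hψ : ContDiff ℝ 1 ψ)
    (hs : HasCompactSupport ψ) : ∫ t, deriv ψ t = 0 := by
  have hc : Continuous (deriv ψ) := hψ.continuous_deriv le_rfl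
  exact integral_eq_zero_of_hasDerivAt_of_integrable
    (fun t => (hψ.differentiable one_ne_zero t).hasDerivAt)
    (hc.integrable_of_hasCompactSupport hs.deriv)
    (hψ.continuous.integrable_of_hasCompactSupport hs)

/-- Integration by parts against a primitive of a locally integrable function. -/
theorem integral_primitive_mul_deriv {g ψ : ℝ → ℂ} (hg : LocallyIntegrable g volume)
    (hψ : ContDiff ℝ 1 ψ) (hs : HasCompactSupport ψ) :
    ∫ x, (∫ y in (0 : ℝ)..x, g y) * deriv ψ x = -∫ x, g x * ψ x := by
  obtain ⟨r, hr, hsub⟩ := exists_tsupport_subset_Ioo hs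
  have hint : ∀ a b : ℝ, IntervalIntegrable g volume a b := fun a b =>
    (hg.locallyIntegrableOn _).integrableOn_isCompact isCompact_uIcc |>.intervalIntegrable
  have hdc : Continuous (deriv ψ) := hψ.continuous_deriv le_rfl
  have hψ0 : ∀ x, x ∉ Ioo (-r) r → ψ x = 0 := fun x hx =>
    image_eq_zero_of_notMem_tsupport fun h => hx (hsub h)
  have hd0 : ∀ x, x ∉ Ioo (-r) r → deriv ψ x = 0 := fun x hx =>
    image_eq_zero_of_notMem_tsupport fun h =>
      hx (hsub (closure_minimal (support_deriv_subset) (isClosed_tsupport _) h))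
  have hprim : Continuous fun x => ∫ y in (-r)..x, g y :=
    intervalIntegral.continuous_primitive hint _
  -- Moving the base point changes the primitive by a constant, which is invisible because `ψ'` has
  -- integral zero. With base point `-r` the claim is Fubini on the triangle `-r < y ≤ x < r`.
  have h1 : ∫ x, (∫ y in (0 : ℝ)..x, g y) * deriv ψ x
      = ∫ x, (∫ y in (-r)..x, g y) * deriv ψ x := by
    have e : ∀ x, (∫ y in (0 : ℝ)..x, g y) * deriv ψ x
        = (∫ y in (-r)..x, g y) * deriv ψ x - (∫ y in (-r)..0, g y) * deriv ψ x := by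
      intro x
      rw [← intervalIntegral.integral_add_adjacent_intervals (hint (-r) 0) (hint 0 x)]
      ring
    simp_rw [e]
    rw [integral_sub, integral_const_mul, integral_deriv_of_hasCompactSupport hψ hs, mul_zero,
      sub_zero]
    · exact (hprim.mul hdc).integrable_of_hasCompactSupport hs.deriv.mul_left
    · exact (continuous_const.mul hdc).integrable_of_hasCompactSupport hs.deriv.mul_left
  rw [h1]
  set S : Set ℝ := Ioo (-r) r with hS
  have hgS : Integrable g (volume.restrict S) :=
    ((hg.locallyIntegrableOn _).integrableOn_isCompact isCompact_Icc).mono_set Ioo_subset_Icc_self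
  have hdS : Integrable (deriv ψ) (volume.restrict S) :=
    (hdc.integrable_of_hasCompactSupport hs.deriv).integrableOn
  have hF : Integrable (Function.uncurry fun x y : ℝ =>
      {p : ℝ × ℝ | p.2 ≤ p.1}.indicator (fun p => deriv ψ p.1 * g p.2) (x, y))
      ((volume.restrict S).prod (volume.restrict S)) :=
    (hdS.mul_prod hgS).indicator (measurableSet_le measurable_snd measurable_fst)
  have hswap := integral_integral_swap hF
  have hl : ∀ x ∈ S, ∫ y in S, {p : ℝ × ℝ | p.2 ≤ p.1}.indicator
      (fun p => deriv ψ p.1 * g p.2) (x, y) = (∫ y in (-r)..x, g y) * deriv ψ x := by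
    intro x hx
    have e : (fun y => {p : ℝ × ℝ | p.2 ≤ p.1}.indicator (fun p => deriv ψ p.1 * g p.2) (x, y))
        = (Iic x).indicator (fun y => deriv ψ x * g y) := by
      ext y; simp [indicator]
    rw [e, setIntegral_indicator measurableSet_Iic, integral_const_mul, mul_comm,
      intervalIntegral.integral_of_le hx.1.le]
    congr 3
    ext y; simp only [hS, mem_inter_iff, mem_Ioo, mem_Iic, mem_Ioc] at hx ⊢
    constructor
    · rintro ⟨h, h'⟩; exact ⟨h.1, h'⟩
    · rintro ⟨h, h'⟩; exact ⟨⟨h, h'.trans_lt hx.2⟩, h'⟩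
  have hrr : ∀ y ∈ S, ∫ x in S, {p : ℝ × ℝ | p.2 ≤ p.1}.indicator
      (fun p => deriv ψ p.1 * g p.2) (x, y) = -(g y * ψ y) := by
    intro y hy
    have e : (fun x => {p : ℝ × ℝ | p.2 ≤ p.1}.indicator (fun p => deriv ψ p.1 * g p.2) (x, y))
        = (Ici y).indicator (fun x => deriv ψ x * g y) := by
      ext x; simp [indicator]
    have e2 : S ∩ Ici y = Ico y r := by
      ext x; simp only [hS, mem_inter_iff, mem_Ioo, mem_Ici, mem_Ico] at hy ⊢
      constructor
      · rintro ⟨h, h'⟩; exact ⟨h', h.2⟩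
      · rintro ⟨h, h'⟩; exact ⟨⟨hy.1.trans_le h, h'⟩, h⟩
    rw [e, setIntegral_indicator measurableSet_Ici, integral_mul_const, e2,
      integral_Ico_eq_integral_Ioc, ← intervalIntegral.integral_of_le hy.2.le,
      intervalIntegral.integral_deriv_eq_sub
        (fun x _ => hψ.differentiable one_ne_zero x) (hdc.intervalIntegrable _ _),
      hψ0 r (by simp [hS])]
    ring
  rw [setIntegral_congr_fun measurableSet_Ioo hl, setIntegral_congr_fun measurableSet_Ioo hrr,
    integral_neg, setIntegral_eq_integral_of_forall_compl_eq_zero,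
    setIntegral_eq_integral_of_forall_compl_eq_zero] at hswap
  · exact hswap
  · intro x hx; rw [hψ0 x hx, mul_zero]
  · intro x hx; rw [hd0 x hx, mul_zero]

/-- The primitive based to the left of the support vanishes there, and it vanishes again to the
right because the total integral is zero. -/
theorem exists_deriv_eq_of_integral_eq_zero {θ : ℝ → ℝ} (hθ : ContDiff ℝ ∞ θ)
    (hs : HasCompactSupport θ) (h0 : ∫ t, θ t = 0) :
    ∃ ψ : ℝ → ℝ, ContDiff ℝ ∞ ψ ∧ HasCompactSupport ψ ∧ ∀ x, HasDerivAt ψ (θ x) x := by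
  obtain ⟨r, hr, hsub⟩ := hs.isBounded.subset_ball_lt 0 (0 : ℝ)
  rw [Real.ball_eq_Ioo, zero_sub, zero_add] at hsub
  have hz : ∀ x, x ∉ Ioo (-r) r → θ x = 0 := fun x hx =>
    image_eq_zero_of_notMem_tsupport fun h => hx (hsub h)
  have hd : ∀ x, HasDerivAt (fun x => ∫ t in (-r)..x, θ t) (θ x) x := fun x =>
    hθ.continuous.integral_hasStrictDerivAt _ _ |>.hasDerivAt
  refine ⟨fun x => ∫ t in (-r)..x, θ t, ?_, ?_, hd⟩
  · rw [contDiff_infty_iff_deriv]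
    exact ⟨fun x => (hd x).differentiableAt, by rwa [funext fun x => (hd x).deriv]⟩
  · refine HasCompactSupport.intro (isCompact_Icc (a := -r) (b := r)) fun x hx => ?_
    rcases lt_or_ge x (-r) with h | h
    · refine intervalIntegral.integral_zero_ae (ae_of_all _ fun t ht => hz t ?_)
      rw [uIoc_of_ge h.le] at ht
      exact fun h' => absurd ht.2 (not_le.2 h'.1)
    · have h2 : r < x := by by_contra h2; exact hx ⟨h, not_lt.1 h2⟩
      rw [intervalIntegral.integral_of_le h, setIntegral_eq_integral_of_forall_compl_eq_zero, h0]
      intro t ht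
      exact hz t fun h' => ht ⟨h'.1, h'.2.le.trans h2.le⟩

/-- The lemma of du Bois-Reymond. -/
theorem ae_eq_const_of_integral_mul_deriv_eq_zero {h : ℝ → ℂ} (hh : LocallyIntegrable h volume)
    (H : ∀ ψ : ℝ → ℂ, ContDiff ℝ ∞ ψ → HasCompactSupport ψ → ∫ t, h t * deriv ψ t = 0) :
    ∃ c : ℂ, h =ᵐ[volume] fun _ => c := by
  let b : ContDiffBump (0 : ℝ) := ⟨1, 2, one_pos, one_lt_two⟩
  set η : ℝ → ℝ := b.normed volume with hη
  have hηc : ContDiff ℝ ∞ η := b.contDiff_normed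
  have hηs : HasCompactSupport η := b.hasCompactSupport_normed
  have hη1 : ∫ t, η t = 1 := b.integral_normed
  refine ⟨∫ t, η t • h t, ae_eq_of_integral_contDiff_smul_eq hh
    (locallyIntegrable_const _) fun φ hφ hφs => ?_⟩
  have hφi := hφ.continuous.integrable_of_hasCompactSupport (μ := volume) hφs
  have hηi := hηc.continuous.integrable_of_hasCompactSupport (μ := volume) hηs
  -- Subtracting `(∫ φ) η` makes the mean of `φ` zero, so the difference is the derivative of a test
  -- function; this is why the constant is `∫ η h`.
  obtain ⟨ψ, hψ, hψs, hd⟩ := exists_deriv_eq_of_integral_eq_zero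
    (θ := fun t => φ t - (∫ s, φ s) * η t) (hφ.sub (contDiff_const.mul hηc))
    (hφs.sub hηs.mul_left) (by
      rw [integral_sub hφi (hηi.const_mul _), integral_const_mul, hη1]; ring)
  have key := H (fun t => (ψ t : ℂ)) (Complex.ofRealCLM.contDiff.comp hψ)
    (hψs.comp_left Complex.ofReal_zero)
  have e : ∀ t, h t * deriv (fun t => (ψ t : ℂ)) t
      = φ t • h t - (∫ s, φ s) • (η t • h t) := by
    intro t
    rw [(hd t).ofReal_comp.deriv]
    simp only [Complex.real_smul]; push_cast; ring
  simp_rw [e] at key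
  rw [integral_sub (hh.integrable_smul_left_of_hasCompactSupport hφ.continuous hφs)
    (g := fun t => (∫ s, φ s) • (η t • h t))
    ((hh.integrable_smul_left_of_hasCompactSupport hηc.continuous hηs).smul (∫ s, φ s)),
    integral_smul, sub_eq_zero] at key
  rw [key, integral_smul_const]

theorem HasWeakDeriv.integral_mul_deriv {f g ψ : ℝ → ℂ} (h : HasWeakDeriv 1 f g)
    (hψ : ContDiff ℝ 1 ψ) (hs : HasCompactSupport ψ) :
    ∫ t, f t * deriv ψ t = -∫ t, g t * ψ t := by
  have := h.2.2 ψ (by exact_mod_cast hψ) hs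
  rw [this, iteratedDeriv_one]; simp

theorem continuous_primitive_of_locallyIntegrable {g : ℝ → ℂ} (hg : LocallyIntegrable g volume) :
    Continuous fun x => ∫ y in (0 : ℝ)..x, g y :=
  intervalIntegral.continuous_primitive (fun _ _ =>
    (hg.locallyIntegrableOn _).integrableOn_isCompact isCompact_uIcc |>.intervalIntegrable) _

theorem ae_eq_const_add_primitive {f g : ℝ → ℂ} (hf : LocallyIntegrable f volume)
    (hg : LocallyIntegrable g volume)
    (h : ∀ ψ : ℝ → ℂ, ContDiff ℝ ∞ ψ → HasCompactSupport ψ →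
      ∫ t, f t * deriv ψ t = -∫ t, g t * ψ t) :
    ∃ c : ℂ, f =ᵐ[volume] fun x => c + ∫ y in (0 : ℝ)..x, g y := by
  have hc := continuous_primitive_of_locallyIntegrable hg
  obtain ⟨c, hc'⟩ := ae_eq_const_of_integral_mul_deriv_eq_zero
    (h := fun x => f x - ∫ y in (0 : ℝ)..x, g y) (hf.sub hc.locallyIntegrable) (by
      intro ψ hψ hs
      have hψ1 : ContDiff ℝ 1 ψ := hψ.of_le (by exact_mod_cast le_top)
      have hd : Continuous (deriv ψ) := hψ1.continuous_deriv le_rfl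
      simp_rw [sub_mul]
      rw [integral_sub (LocallyIntegrable.integrable_mul_of_hasCompactSupport hf hd hs.deriv)
        (g := fun t => (∫ y in (0 : ℝ)..t, g y) * deriv ψ t)
        ((hc.mul hd).integrable_of_hasCompactSupport hs.deriv.mul_left),
        h ψ hψ hs, integral_primitive_mul_deriv hg hψ1 hs, sub_self])
  refine ⟨c, hc'.mono fun x hx => ?_⟩
  simp only at hx ⊢
  rw [← hx]; ring

/-- A function with a weak derivative of order one and of order two has a continuously
differentiable representative, and its second weak derivative is the weak derivative of its
first one. -/
theorem HasWeakDeriv.exists_representative {u g₁ g₂ : ℝ → ℂ} (h₁ : HasWeakDeriv 1 u g₁)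
    (h₂ : HasWeakDeriv 2 u g₂) :
    ∃ U : ℝ → ℂ, ContDiff ℝ 1 U ∧ u =ᵐ[volume] U ∧ g₁ =ᵐ[volume] deriv U ∧
      ∀ ψ : ℝ → ℂ, ContDiff ℝ 1 ψ → HasCompactSupport ψ →
        ∫ t, g₂ t * ψ t = -∫ t, g₁ t * deriv ψ t := by
  -- The order-one identity tested with `ψ'` is compared with the order-two identity tested with
  -- `ψ`.
  have hsm : ∀ ψ : ℝ → ℂ, ContDiff ℝ ∞ ψ → HasCompactSupport ψ →
      ∫ t, g₁ t * deriv ψ t = -∫ t, g₂ t * ψ t := by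
    intro ψ hψ hs
    have e2 := h₂.2.2 ψ (contDiff_infty.1 hψ 2) hs
    have hd : ContDiff ℝ ∞ (deriv ψ) := (contDiff_infty_iff_deriv.1 hψ).2
    have e1 := h₁.integral_mul_deriv (hd.of_le (by exact_mod_cast le_top)) hs.deriv
    rw [e2, iteratedDeriv_succ, iteratedDeriv_one, e1]; simp
  obtain ⟨d, hd⟩ := ae_eq_const_add_primitive h₁.2.1 h₂.2.1 hsm
  obtain ⟨c, hc⟩ := ae_eq_const_add_primitive h₁.1 h₁.2.1 fun ψ hψ hs =>
    h₁.integral_mul_deriv (hψ.of_le (by exact_mod_cast le_top)) hs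
  set V : ℝ → ℂ := fun x => d + ∫ y in (0 : ℝ)..x, g₂ y with hV
  have hVc : Continuous V :=
    continuous_const.add (continuous_primitive_of_locallyIntegrable h₂.2.1)
  have hder : ∀ x, HasDerivAt (fun x => c + ∫ y in (0 : ℝ)..x, V y) (V x) x := fun x =>
    (hVc.integral_hasStrictDerivAt _ _ |>.hasDerivAt).const_add c
  have hdV : deriv (fun x => c + ∫ y in (0 : ℝ)..x, V y) = V := funext fun x => (hder x).deriv
  refine ⟨fun x => c + ∫ y in (0 : ℝ)..x, V y, ?_, ?_, ?_, ?_⟩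
  · rw [contDiff_one_iff_deriv, hdV]
    exact ⟨fun x => (hder x).differentiableAt, hVc⟩
  · refine hc.trans (Eventually.of_forall fun x => ?_)
    simp only
    rw [intervalIntegral.integral_congr_ae (hd.mono fun y hy _ => hy)]
  · rw [hdV]; exact hd
  -- The identity `hsm` holds only for smooth `ψ`; replacing `g₁` by the primitive `V` extends it to
  -- `C¹` test functions.
  · intro ψ hψ hs
    have hdc : Continuous (deriv ψ) := hψ.continuous_deriv le_rfl
    have e : ∫ t, g₁ t * deriv ψ t = ∫ t, V t * deriv ψ t :=
      integral_congr_ae (hd.mono fun t ht => by simp only [ht])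
    rw [e]
    simp only [hV, add_mul]
    rw [integral_add (f := fun t => d * deriv ψ t)
      (g := fun t => (∫ y in (0 : ℝ)..t, g₂ y) * deriv ψ t) ((continuous_const.mul hdc).integrable_of_hasCompactSupport
      hs.deriv.mul_left) (((continuous_primitive_of_locallyIntegrable h₂.2.1).mul
      hdc).integrable_of_hasCompactSupport hs.deriv.mul_left), integral_const_mul,
      integral_deriv_of_hasCompactSupport hψ hs, integral_primitive_mul_deriv h₂.2.1 hψ hs]
    ring

/-- The test function is `φ Ū` with `U` the `C¹` representative of `u`; it is only `C¹`, so smooth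
test functions would not suffice. -/
theorem integral_weight_mul_conj_mul {u g₁ g₂ : ℝ → ℂ} (h₁ : HasWeakDeriv 1 u g₁)
    (h₂ : HasWeakDeriv 2 u g₂) {φ : ℝ → ℝ} (hφ : ContDiff ℝ 1 φ) (hs : HasCompactSupport φ) :
    ∫ t, (φ t : ℂ) * (starRingEnd ℂ (u t) * g₂ t)
      = -∫ t, (((deriv φ t : ℝ) : ℂ) * (starRingEnd ℂ (u t) * g₁ t)
        + (φ t : ℂ) * (starRingEnd ℂ (g₁ t) * g₁ t)) := by
  obtain ⟨U, hU, huU, hgU, H⟩ := h₁.exists_representative h₂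
  have hd : ∀ x, HasDerivAt (fun t => (φ t : ℂ) * starRingEnd ℂ (U t))
      (((deriv φ x : ℝ) : ℂ) * starRingEnd ℂ (U x) + (φ x : ℂ) * starRingEnd ℂ (deriv U x)) x := by
    intro x
    have a := (hφ.differentiable one_ne_zero x).hasDerivAt.ofReal_comp
    have b := (hU.differentiable one_ne_zero x).hasDerivAt.star
    exact a.mul b
  have key := H (fun t => (φ t : ℂ) * starRingEnd ℂ (U t))
    ((Complex.ofRealCLM.contDiff.comp hφ).mul
      (Complex.conjCLE.toContinuousLinearMap.contDiff.comp hU))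
    (HasCompactSupport.mul_right (hs.comp_left (g := fun x : ℝ => (x : ℂ)) Complex.ofReal_zero))
  rw [integral_congr_ae (g := fun t => g₂ t * ((φ t : ℂ) * starRingEnd ℂ (U t))), key]
  · congr 1
    refine integral_congr_ae ?_
    filter_upwards [huU, hgU] with t a b
    rw [(hd t).deriv, a, b]; ring
  · filter_upwards [huU] with t a
    rw [a]; ring


/-! ### Sobolev norms and uniform bounds on compact intervals -/

theorem HasWeakDeriv.ae_unique {α : ℕ} {f g g' : ℝ → ℂ} (h : HasWeakDeriv α f g)
    (h' : HasWeakDeriv α f g') : g =ᵐ[volume] g' := by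
  refine ae_eq_of_integral_contDiff_smul_eq h.2.1 h'.2.1 fun φ hφ hs => ?_
  have hc : ContDiff ℝ α fun t => (φ t : ℂ) :=
    Complex.ofRealCLM.contDiff.comp (contDiff_infty.1 hφ α)
  have hcs : HasCompactSupport fun t => (φ t : ℂ) :=
    hs.comp_left (g := fun x : ℝ => (x : ℂ)) Complex.ofReal_zero
  have := (h.2.2 _ hc hcs).trans (h'.2.2 _ hc hcs).symm
  simpa only [Complex.real_smul, mul_comm] using this

theorem HasWeakDeriv.hasWeakDeriv_weakDeriv {α : ℕ} {f g : ℝ → ℂ} (h : HasWeakDeriv α f g) :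
    HasWeakDeriv α f (weakDeriv α f) := by
  have hex : ∃ g, HasWeakDeriv α f g := ⟨g, h⟩
  rw [weakDeriv, dif_pos hex]
  exact hex.choose_spec

theorem HasWeakDeriv.weakDeriv_ae_eq {α : ℕ} {f g : ℝ → ℂ} (h : HasWeakDeriv α f g) :
    weakDeriv α f =ᵐ[volume] g :=
  h.hasWeakDeriv_weakDeriv.ae_unique h

theorem HasWeakDeriv.sub {α : ℕ} {f₁ f₂ g₁ g₂ : ℝ → ℂ} (h₁ : HasWeakDeriv α f₁ g₁)
    (h₂ : HasWeakDeriv α f₂ g₂) : HasWeakDeriv α (f₁ - f₂) (g₁ - g₂) := by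
  refine ⟨h₁.1.sub h₂.1, h₁.2.1.sub h₂.2.1, fun φ hφ hs => ?_⟩
  have hc : Continuous (iteratedDeriv α φ) := hφ.continuous_iteratedDeriv' α
  have hcs : HasCompactSupport (iteratedDeriv α φ) := by
    clear hφ hc h₁ h₂
    induction α with
    | zero => simpa using hs
    | succ n ih => rw [iteratedDeriv_succ]; exact ih.deriv
  simp only [Pi.sub_apply, sub_mul]
  rw [integral_sub (LocallyIntegrable.integrable_mul_of_hasCompactSupport h₁.2.1 hφ.continuous hs)
      (LocallyIntegrable.integrable_mul_of_hasCompactSupport h₂.2.1 hφ.continuous hs),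
    integral_sub (LocallyIntegrable.integrable_mul_of_hasCompactSupport h₁.1 hc hcs)
      (LocallyIntegrable.integrable_mul_of_hasCompactSupport h₂.1 hc hcs),
    h₁.2.2 φ hφ hs, h₂.2.2 φ hφ hs, mul_sub]

theorem hasWeakDeriv_zero {f : ℝ → ℂ} (hf : LocallyIntegrable f volume) : HasWeakDeriv 0 f f :=
  ⟨hf, hf, fun φ _ _ => by simp⟩

theorem MemSobolev.hasWeakDeriv {m α : ℕ} {f : ℝ → ℂ} (hf : MemSobolev m f) (hα : α ≤ m) :
    HasWeakDeriv α f (weakDeriv α f) := by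
  obtain ⟨g, hg, -⟩ := hf.2 α hα
  exact hg.hasWeakDeriv_weakDeriv

theorem MemSobolev.memLp_weakDeriv {m α : ℕ} {f : ℝ → ℂ} (hf : MemSobolev m f) (hα : α ≤ m) :
    MemLp (weakDeriv α f) 2 volume := by
  obtain ⟨g, hg, hg2⟩ := hf.2 α hα
  exact (memLp_congr_ae hg.weakDeriv_ae_eq).2 hg2

theorem MemSobolev.weakDeriv_zero_ae_eq {m : ℕ} {f : ℝ → ℂ} (hf : MemSobolev m f) :
    weakDeriv 0 f =ᵐ[volume] f :=
  (hasWeakDeriv_zero (hf.1.locallyIntegrable (by norm_num))).weakDeriv_ae_eq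

theorem eLpNorm_weakDeriv_le_sobolevNorm {m α : ℕ} (hα : α ≤ m) (f : ℝ → ℂ) :
    eLpNorm (weakDeriv α f) 2 volume ≤ sobolevNorm m f := by
  have h : eLpNorm (weakDeriv α f) 2 volume ^ 2
      ≤ ∑ β ∈ Finset.range (m + 1), eLpNorm (weakDeriv β f) 2 volume ^ 2 :=
    Finset.single_le_sum (f := fun β => eLpNorm (weakDeriv β f) 2 volume ^ 2)
      (fun _ _ => zero_le) (Finset.mem_range.2 (by omega))
  calc eLpNorm (weakDeriv α f) 2 volume
      = (eLpNorm (weakDeriv α f) 2 volume ^ 2) ^ (1 / 2 : ℝ) := by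
        rw [← ENNReal.rpow_natCast, ← ENNReal.rpow_mul]; norm_num
    _ ≤ sobolevNorm m f := ENNReal.rpow_le_rpow h (by norm_num)

/-- The `L²` norm as a real number. -/
noncomputable def normL2 (f : ℝ → ℂ) : ℝ := (eLpNorm f 2 volume).toReal

theorem normL2_nonneg (f : ℝ → ℂ) : 0 ≤ normL2 f := ENNReal.toReal_nonneg

theorem eLpNorm_weakDeriv_le_add {m α : ℕ} (hα : α ≤ m) {f g : ℝ → ℂ} (hf : MemSobolev m f)
    (hg : MemSobolev m g) :
    eLpNorm (weakDeriv α f) 2 volume ≤ sobolevNorm m (f - g) + eLpNorm (weakDeriv α g) 2 volume := by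
  have e : weakDeriv α f =ᵐ[volume] weakDeriv α (f - g) + weakDeriv α g := by
    filter_upwards [((hf.hasWeakDeriv hα).sub (hg.hasWeakDeriv hα)).weakDeriv_ae_eq] with t ht
    simp [ht]
  have hm : AEStronglyMeasurable (weakDeriv α (f - g)) volume :=
    ((hf.hasWeakDeriv hα).sub
      (hg.hasWeakDeriv hα)).hasWeakDeriv_weakDeriv.2.1.aestronglyMeasurable
  rw [eLpNorm_congr_ae e]
  exact (eLpNorm_add_le hm (hg.memLp_weakDeriv hα).1 (by norm_num)).trans
    (add_le_add_left (eLpNorm_weakDeriv_le_sobolevNorm hα _) _)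

/-- Near each `Z` the norm is at most one plus its value at `Z`; compactness leaves finitely many
such bounds. -/
theorem ContinuousInSobolev.exists_bound {m : ℕ} {J : Set ℝ} {Q : ℝ → ℝ → ℂ} (hJ : IsCompact J)
    (hQ : ContinuousInSobolev m J Q) {α : ℕ} (hα : α ≤ m) :
    ∃ M : ℝ, 0 ≤ M ∧ ∀ Z ∈ J, normL2 (weakDeriv α (Q Z)) ≤ M := by
  -- The repeated `Z ∈ J` matches the induction predicate, whose sets need not lie inside `J`.
  suffices h : ∃ M : ℝ≥0∞, M ≠ ⊤ ∧ ∀ Z ∈ J, Z ∈ J → eLpNorm (weakDeriv α (Q Z)) 2 volume ≤ M by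
    obtain ⟨M, hM, h⟩ := h
    exact ⟨M.toReal, ENNReal.toReal_nonneg, fun Z hZ => ENNReal.toReal_mono hM (h Z hZ hZ)⟩
  refine hJ.induction_on
    (p := fun s => ∃ M : ℝ≥0∞, M ≠ ⊤ ∧ ∀ Z ∈ s, Z ∈ J → eLpNorm (weakDeriv α (Q Z)) 2 volume ≤ M)
    ⟨0, by simp, by simp⟩ ?_ ?_ ?_
  · rintro s t hst ⟨M, hM, h⟩
    exact ⟨M, hM, fun Z hZ => h Z (hst hZ)⟩
  · rintro s t ⟨M, hM, h⟩ ⟨M', hM', h'⟩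
    refine ⟨max M M', by simp [hM, hM'], ?_⟩
    rintro Z (hZ | hZ) hZJ
    · exact (h Z hZ hZJ).trans (le_max_left _ _)
    · exact (h' Z hZ hZJ).trans (le_max_right _ _)
  · intro Z hZ
    refine ⟨{Y | sobolevNorm m (Q Y - Q Z) ≤ 1},
      (hQ.2 Z hZ).eventually (Iic_mem_nhds (by norm_num : (0 : ℝ≥0∞) < 1)),
      1 + eLpNorm (weakDeriv α (Q Z)) 2 volume, ?_, fun Y hY hYJ => ?_⟩
    · exact ENNReal.add_ne_top.2 ⟨by simp, ((hQ.1 Z hZ).memLp_weakDeriv hα).2.ne⟩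
    · exact (eLpNorm_weakDeriv_le_add hα (hQ.1 Y hYJ) (hQ.1 Z hZ)).trans
        (add_le_add_left hY _)

/-! ### Weighted `L²` estimates -/

theorem norm_integral_conj_mul_le {f g : ℝ → ℂ} (hf : MemLp f 2 volume) (hg : MemLp g 2 volume) :
    ‖∫ t, starRingEnd ℂ (f t) * g t‖ ≤ normL2 f * normL2 g := by
  have h := norm_inner_le_norm (𝕜 := ℂ) hf.toLp hg.toLp
  rw [L2.inner_def, Lp.norm_toLp, Lp.norm_toLp] at h
  refine le_trans (le_of_eq ?_) h
  congr 1
  refine integral_congr_ae ?_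
  filter_upwards [hf.coeFn_toLp, hg.coeFn_toLp] with t a b
  rw [a, b, RCLike.inner_apply, mul_comm]

theorem integral_conj_mul_self {f : ℝ → ℂ} (hf : MemLp f 2 volume) :
    ∫ t, starRingEnd ℂ (f t) * f t = ((normL2 f ^ 2 : ℝ) : ℂ) := by
  have h := inner_self_eq_norm_sq_to_K (𝕜 := ℂ) hf.toLp
  rw [L2.inner_def, Lp.norm_toLp] at h
  rw [Complex.ofReal_pow]
  refine Eq.trans ?_ h
  refine integral_congr_ae ?_
  filter_upwards [hf.coeFn_toLp] with t a
  rw [a, RCLike.inner_apply, mul_comm]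

theorem memLp_weight_mul {θ : ℝ → ℝ} (hθ : Continuous θ) (hs : HasCompactSupport θ) {f : ℝ → ℂ}
    (hf : MemLp f 2 volume) : MemLp (fun t => (θ t : ℂ) * f t) 2 volume := by
  obtain ⟨B, hB⟩ := hs.exists_bound_of_continuous hθ
  refine hf.of_le_mul (c := B)
    ((Complex.continuous_ofReal.comp hθ).aestronglyMeasurable.mul hf.1) (ae_of_all _ fun t => ?_)
  rw [norm_mul, Complex.norm_real]
  exact mul_le_mul_of_nonneg_right (hB t) (norm_nonneg _)


theorem normL2_weight_mul_le {η : ℝ → ℝ} {C : ℝ} (hη : ∀ t, |η t| ≤ C) {f : ℝ → ℂ}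
    (hf : MemLp f 2 volume) : normL2 (fun t => (η t : ℂ) * f t) ≤ C * normL2 f := by
  have hC : 0 ≤ C := (abs_nonneg _).trans (hη 0)
  have h : eLpNorm (fun t => (η t : ℂ) * f t) 2 volume
      ≤ ENNReal.ofReal C * eLpNorm f 2 volume := by
    refine eLpNorm_le_mul_eLpNorm_of_ae_le_mul (ae_of_all _ fun t => ?_) 2
    rw [norm_mul, Complex.norm_real]
    exact mul_le_mul_of_nonneg_right (hη t) (norm_nonneg _)
  have := ENNReal.toReal_mono (ENNReal.mul_ne_top ENNReal.ofReal_ne_top hf.2.ne) h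
  rwa [ENNReal.toReal_mul, ENNReal.toReal_ofReal hC] at this

/-- The basic weighted estimate, for a weight `θ` with `|θ'| ≤ C`. -/
theorem abs_im_integral_weight_le {u g₁ g₂ : ℝ → ℂ} (hu : MemLp u 2 volume)
    (hg₁ : MemLp g₁ 2 volume) (hg₂ : MemLp g₂ 2 volume) (h₁ : HasWeakDeriv 1 u g₁)
    (h₂ : HasWeakDeriv 2 u g₂) {M : ℝ} (huM : normL2 u ≤ M) (hgM : normL2 g₂ ≤ M)
    {θ : ℝ → ℝ} (hθ : ContDiff ℝ 1 θ) (hs : HasCompactSupport θ) {C : ℝ}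
    (hC : ∀ t, |deriv θ t| ≤ C) :
    |(∫ t, ((θ t ^ 4 : ℝ) : ℂ) * (starRingEnd ℂ (u t) * g₂ t)).im|
      ≤ 4 * C * normL2 (fun t => ((θ t ^ 2 : ℝ) : ℂ) * u t) ^ 2
        + 2 * C * (4 * C ^ 2 + 1) * M ^ 2 := by
  have hC0 : 0 ≤ C := (abs_nonneg _).trans (hC 0)
  have hdc : Continuous (deriv θ) := hθ.continuous_deriv le_rfl
  have hs2 : HasCompactSupport fun t => θ t ^ 2 := hs.comp_left (g := fun x => x ^ 2) (by simp)
  have hs4 : HasCompactSupport fun t => θ t ^ 4 := hs.comp_left (g := fun x => x ^ 4) (by simp)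
  have d2 : ∀ t, deriv (fun t => θ t ^ 2) t = 2 * θ t * deriv θ t := fun t => by
    have := ((hθ.differentiable one_ne_zero t).hasDerivAt.fun_pow 2).deriv
    simpa using this
  have d4 : ∀ t, deriv (fun t => θ t ^ 4) t = 4 * θ t ^ 3 * deriv θ t := fun t => by
    have := ((hθ.differentiable one_ne_zero t).hasDerivAt.fun_pow 4).deriv
    simpa using this
  have mA : MemLp (fun t => ((θ t ^ 2 : ℝ) : ℂ) * u t) 2 volume :=
    memLp_weight_mul (hθ.continuous.pow 2) hs2 hu
  have mB : MemLp (fun t => (θ t : ℂ) * g₁ t) 2 volume := memLp_weight_mul hθ.continuous hs hg₁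
  have mB2 : MemLp (fun t => ((θ t ^ 2 : ℝ) : ℂ) * g₁ t) 2 volume :=
    memLp_weight_mul (hθ.continuous.pow 2) hs2 hg₁
  have mD : MemLp (fun t => ((deriv θ t : ℝ) : ℂ) * u t) 2 volume :=
    memLp_weight_mul hdc hs.deriv hu
  have mDB : MemLp (fun t => ((deriv θ t : ℝ) : ℂ) * ((θ t : ℂ) * g₁ t)) 2 volume :=
    memLp_weight_mul hdc hs.deriv mB
  have int : ∀ {f g : ℝ → ℂ}, MemLp f 2 volume → MemLp g 2 volume →
      Integrable (fun t => starRingEnd ℂ (f t) * g t) volume := fun hf hg =>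
    hf.star.integrable_mul hg
  set a := normL2 (fun t => ((θ t ^ 2 : ℝ) : ℂ) * u t) with ha
  set b := normL2 (fun t => (θ t : ℂ) * g₁ t) with hb
  have ha0 : 0 ≤ a := normL2_nonneg _
  have hb0 : 0 ≤ b := normL2_nonneg _
  have hDM : normL2 (fun t => ((deriv θ t : ℝ) : ℂ) * u t) ≤ C * M :=
    (normL2_weight_mul_le hC hu).trans (mul_le_mul_of_nonneg_left huM hC0)
  have hDB : normL2 (fun t => ((deriv θ t : ℝ) : ℂ) * ((θ t : ℂ) * g₁ t)) ≤ C * b :=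
    normL2_weight_mul_le hC mB
  -- Weight `θ²`: this identity is solved for `b²` to control the first derivative.
  have i2 : ∫ t, starRingEnd ℂ (((θ t ^ 2 : ℝ) : ℂ) * u t) * g₂ t
      = -(2 * ∫ t, starRingEnd ℂ (((deriv θ t : ℝ) : ℂ) * u t) * ((θ t : ℂ) * g₁ t))
        - ((b ^ 2 : ℝ) : ℂ) := by
    rw [← integral_conj_mul_self mB, ← integral_const_mul, ← neg_add', ← integral_add
      ((int mD mB).const_mul 2) (int mB mB)]
    have := integral_weight_mul_conj_mul h₁ h₂ (hθ.pow 2) hs2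
    simp only [d2] at this
    refine Eq.trans ?_ (this.trans ?_)
    · congr 1; ext t; simp only [map_mul, Complex.conj_ofReal]; ring
    · congr 2; ext t; simp only [map_mul, Complex.conj_ofReal]; push_cast; ring
  -- Weight `θ⁴`: the last term is real and drops out of the imaginary part. The factor `θ³θ'` is
  -- split as `θ²` on `u` and `θ'θ` on `g₁`.
  have i4 : ∫ t, ((θ t ^ 4 : ℝ) : ℂ) * (starRingEnd ℂ (u t) * g₂ t)
      = -(4 * ∫ t, starRingEnd ℂ (((θ t ^ 2 : ℝ) : ℂ) * u t) *
          (((deriv θ t : ℝ) : ℂ) * ((θ t : ℂ) * g₁ t)))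
        - ((normL2 (fun t => ((θ t ^ 2 : ℝ) : ℂ) * g₁ t) ^ 2 : ℝ) : ℂ) := by
    rw [← integral_conj_mul_self mB2, ← integral_const_mul, ← neg_add', ← integral_add
      ((int mA mDB).const_mul 4) (int mB2 mB2)]
    have := integral_weight_mul_conj_mul h₁ h₂ (hθ.pow 4) hs4
    simp only [d4] at this
    refine this.trans ?_
    congr 2; ext t; simp only [map_mul, Complex.conj_ofReal]; push_cast; ring
  have hbb : b ^ 2 ≤ 2 * (C * M * b) + a * M := by
    have e : ((b ^ 2 : ℝ) : ℂ)
        = -(2 * ∫ t, starRingEnd ℂ (((deriv θ t : ℝ) : ℂ) * u t) * ((θ t : ℂ) * g₁ t))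
          - ∫ t, starRingEnd ℂ (((θ t ^ 2 : ℝ) : ℂ) * u t) * g₂ t := by rw [i2]; ring
    have n : b ^ 2 = ‖((b ^ 2 : ℝ) : ℂ)‖ := by
      rw [Complex.norm_real, Real.norm_of_nonneg (sq_nonneg b)]
    rw [n, e]
    refine (norm_sub_le _ _).trans (add_le_add ?_ ?_)
    · rw [norm_neg, norm_mul, Complex.norm_ofNat]
      exact mul_le_mul_of_nonneg_left ((norm_integral_conj_mul_le mD mB).trans
        (mul_le_mul_of_nonneg_right hDM hb0)) zero_le_two
    · exact (norm_integral_conj_mul_le mA hg₂).trans (mul_le_mul_of_nonneg_left hgM ha0)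
  have him : |(∫ t, ((θ t ^ 4 : ℝ) : ℂ) * (starRingEnd ℂ (u t) * g₂ t)).im|
      ≤ 4 * (a * (C * b)) := by
    rw [i4, Complex.sub_im, Complex.ofReal_im, sub_zero]
    refine (Complex.abs_im_le_norm _).trans ?_
    rw [norm_neg, norm_mul, Complex.norm_ofNat]
    exact mul_le_mul_of_nonneg_left ((norm_integral_conj_mul_le mA mDB).trans
      (mul_le_mul_of_nonneg_left hDB ha0)) (by norm_num)
  refine him.trans ?_
  -- Young's inequality: `2CMb ≤ b²/2 + 2C²M²` and `aM ≤ (a² + M²)/2`, with `b²/2` absorbed on the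
  -- left. The final step uses `4Cab ≤ 2C(a² + b²)`.
  have hb2 : b ^ 2 ≤ a ^ 2 + (4 * C ^ 2 + 1) * M ^ 2 := by
    nlinarith [sq_nonneg (b - 2 * (C * M)), sq_nonneg (a - M)]
  nlinarith [mul_nonneg hC0 (sq_nonneg (a - b)), mul_le_mul_of_nonneg_left hb2 hC0]

/-! ### Evolution of the weighted norm and removal of the cutoff -/

/-- Multiplication by `w` is bounded on `L²`, so it preserves differentiability of the curve; the
squared norm is then differentiated in the Hilbert space. -/
theorem hasDerivWithinAt_normL2_sq {Q : ℝ → ℝ → ℂ} {J : Set ℝ} {R : ℝ → ℂ} {Z : ℝ}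
    (hQ : ∀ Y ∈ J, MemLp (Q Y) 2 volume) (hZ : Z ∈ J) (hR : HasL2DerivWithin Q R J Z)
    {w : ℝ → ℝ} (hw : Continuous w) (hs : HasCompactSupport w) :
    HasDerivWithinAt (fun Y => normL2 (fun t => (w t : ℂ) * Q Y t) ^ 2)
      (2 * (∫ t, ((w t ^ 2 : ℝ) : ℂ) * (starRingEnd ℂ (Q Z t) * R t)).re) J Z := by
  classical
  have mem : ∀ {f : ℝ → ℂ}, MemLp f 2 volume → MemLp (fun t => (w t : ℂ) * f t) 2 volume :=
    fun hf => memLp_weight_mul hw hs hf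
  -- The value `0` is never taken on `J`, and only derivatives within `J` matter.
  let p : ℝ → Lp ℂ 2 (volume : Measure ℝ) := fun Y =>
    if h : MemLp (fun t => (w t : ℂ) * Q Y t) 2 volume then h.toLp else 0
  have hp : ∀ Y (hY : Y ∈ J), p Y = (mem (hQ Y hY)).toLp := fun Y hY => dif_pos (mem (hQ Y hY))
  have hpd : HasDerivWithinAt p ((mem hR.1).toLp) J Z := by
    rw [hasDerivWithinAt_iff_tendsto_slope, tendsto_iff_norm_sub_tendsto_zero]
    obtain ⟨B, hB⟩ := hs.exists_bound_of_continuous hw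
    have hlim : Tendsto (fun Y => B *
        normL2 (fun T => (Q Y T - Q Z T) / ((Y - Z : ℝ) : ℂ) - R T)) (𝓝[J \ {Z}] Z) (𝓝 0) := by
      simpa [normL2, Function.comp_def] using ((ENNReal.tendsto_toReal ENNReal.zero_ne_top).comp hR.2).const_mul B
    refine squeeze_zero' (Eventually.of_forall fun _ => norm_nonneg _) ?_ hlim
    filter_upwards [self_mem_nhdsWithin] with Y hY
    have hD : MemLp (fun T => (Q Y T - Q Z T) / ((Y - Z : ℝ) : ℂ) - R T) 2 volume := by
      have := (((hQ Y hY.1).sub (hQ Z hZ)).const_mul ((Y - Z : ℝ) : ℂ)⁻¹).sub hR.1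
      refine (memLp_congr_ae (Eventually.of_forall fun T => ?_)).1 this
      simp only [Pi.sub_apply]; ring
    have e : slope p Z Y - (mem hR.1).toLp = (mem hD).toLp := by
      rw [slope_def_module, hp Y hY.1, hp Z hZ, ← MemLp.toLp_sub, ← MemLp.toLp_const_smul,
        ← MemLp.toLp_sub, MemLp.toLp_eq_toLp_iff]
      refine Eventually.of_forall fun T => ?_
      simp only [Pi.sub_apply, Pi.smul_apply, Complex.real_smul]
      push_cast; ring
    rw [e, Lp.norm_toLp]
    exact normL2_weight_mul_le hB hD
  have h := hpd.norm_sq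
  rw [hp Z hZ, L2.inner_def] at h
  have h2 : HasDerivWithinAt (fun Y => normL2 (fun t => (w t : ℂ) * Q Y t) ^ 2) _ J Z :=
    h.congr (fun Y hY => by rw [hp Y hY, Lp.norm_toLp, normL2])
      (by rw [hp Z hZ, Lp.norm_toLp, normL2])
  convert h2 using 2
  have hi : Integrable (fun t => ((w t ^ 2 : ℝ) : ℂ) * (starRingEnd ℂ (Q Z t) * R t)) volume := by
    have := (mem (hQ Z hZ)).star.integrable_mul (mem hR.1)
    refine this.congr (Eventually.of_forall fun t => ?_)
    simp; ring
  rw [← RCLike.re_eq_complex_re, ← integral_re hi]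
  refine integral_congr_ae ?_
  filter_upwards [(mem (hQ Z hZ)).coeFn_toLp, (mem hR.1).coeFn_toLp] with t a b
  rw [a, b, Complex.inner, RCLike.re_eq_complex_re]
  congr 1
  simp only [map_mul, Complex.conj_ofReal]; push_cast; ring

/-- After multiplication by `ū` the nonlinearity becomes `i` times a real function. It disappears
pointwise, before integration, so no integrability of `|u|⁴` is required. -/
theorem re_integral_weight_eq_neg_im {u g R : ℝ → ℂ} {ρ : ℝ} (φ : ℝ → ℝ)
    (hi : Integrable (fun t => (φ t : ℂ) * (starRingEnd ℂ (u t) * g t)) volume)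
    (hi' : Integrable (fun t => (φ t : ℂ) * (starRingEnd ℂ (u t) * R t)) volume)
    (h : ∀ᵐ t ∂volume, Complex.I * R t + g t + (ρ : ℂ) * ((‖u t‖ : ℂ) ^ 2 * u t) = 0) :
    (∫ t, (φ t : ℂ) * (starRingEnd ℂ (u t) * R t)).re
      = -(∫ t, (φ t : ℂ) * (starRingEnd ℂ (u t) * g t)).im := by
  rw [← RCLike.re_eq_complex_re, ← RCLike.im_eq_complex_im, ← integral_re hi', ← integral_im hi,
    ← integral_neg]
  refine integral_congr_ae ?_
  filter_upwards [h] with t ht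
  have hR : R t = Complex.I * (g t + (ρ : ℂ) * ((‖u t‖ : ℂ) ^ 2 * u t)) := by
    linear_combination (-Complex.I) * ht + R t * Complex.I_mul_I
  have e : (φ t : ℂ) * (starRingEnd ℂ (u t) * R t)
      = Complex.I * ((φ t : ℂ) * (starRingEnd ℂ (u t) * g t))
        + Complex.I * ((φ t * ρ * ‖u t‖ ^ 4 : ℝ) : ℂ) := by
    have := Complex.conj_mul' (u t)
    rw [hR]; push_cast
    linear_combination Complex.I * φ t * ρ * (‖u t‖ : ℂ) ^ 2 * this
  rw [RCLike.re_eq_complex_re, RCLike.im_eq_complex_im, e, Complex.add_re, Complex.I_mul_re,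
    Complex.I_mul_re, Complex.ofReal_im]
  ring

/-- Compactly supported weights that increase to `|t|` with uniformly bounded slope. -/
theorem exists_weights : ∃ (θ : ℕ → ℝ → ℝ) (C : ℝ), ∀ n, ContDiff ℝ 1 (θ n) ∧
    HasCompactSupport (θ n) ∧ (∀ t, |deriv (θ n) t| ≤ C) ∧ (∀ t, |θ n t| ≤ |t|) ∧
    ∀ t : ℝ, |t| ≤ n + 1 → θ n t = t := by
  obtain ⟨b, hb, hbs, h0, h1, hb1⟩ : ∃ b : ℝ → ℝ, ContDiff ℝ 1 b ∧ HasCompactSupport b ∧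
      (∀ s, 0 ≤ b s) ∧ (∀ s, b s ≤ 1) ∧ ∀ s, |s| ≤ 1 → b s = 1 := by
    let b : ContDiffBump (0 : ℝ) := ⟨1, 2, one_pos, one_lt_two⟩
    exact ⟨b, b.contDiff, b.hasCompactSupport, fun _ => b.nonneg, fun _ => b.le_one,
      fun s hs => b.one_of_mem_closedBall (by simpa using hs)⟩
  have hbd : Continuous (deriv b) := hb.continuous_deriv le_rfl
  -- With `s = t/(n+1)`, the derivative of `t b(t/(n+1))` is `b(s) + s b'(s)`, whose bound `1 + B`
  -- does not depend on `n`.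
  obtain ⟨B, hB⟩ := (hbs.deriv.mul_left (f := fun s : ℝ => s)).exists_bound_of_continuous
    (continuous_id.mul hbd)
  refine ⟨fun n t => t * b (t / (n + 1)), 1 + B, fun n => ?_⟩
  have hn : (0 : ℝ) < n + 1 := by positivity
  have habs : ∀ s, |b s| ≤ 1 := fun s => by rw [abs_of_nonneg (h0 s)]; exact h1 s
  refine ⟨contDiff_id.mul (hb.comp (contDiff_id.div_const _)), ?_, fun t => ?_, fun t => ?_,
    fun t ht => ?_⟩
  · refine HasCompactSupport.mul_left (f := fun t : ℝ => t) (f' := fun t => b (t / (n + 1))) ?_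
    simp only [div_eq_mul_inv]
    exact hbs.comp_homeomorph (Homeomorph.mulRight₀ ((n : ℝ) + 1)⁻¹ (by positivity))
  · have hd : HasDerivAt (fun t : ℝ => t * b (t / (n + 1)))
        (1 * b (t / (n + 1)) + t * (deriv b (t / (n + 1)) * (1 / (n + 1)))) t :=
      (hasDerivAt_id t).mul (HasDerivAt.comp t
        (hb.differentiable one_ne_zero _).hasDerivAt ((hasDerivAt_id t).div_const _))
    rw [hd.deriv, show 1 * b (t / (n + 1)) + t * (deriv b (t / (n + 1)) * (1 / (n + 1)))
      = b (t / (n + 1)) + (t / (n + 1)) * deriv b (t / (n + 1)) by ring]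
    exact (abs_add_le _ _).trans (add_le_add (habs _) (hB _))
  · rw [abs_mul]
    exact mul_le_of_le_one_right (abs_nonneg _) (habs _)
  · have : b (t / (n + 1)) = 1 := hb1 _ (by
      rw [abs_div, abs_of_pos hn]
      exact (div_le_one hn).2 ht)
    simp [this]

/-- The order of quantifiers is the point: `K` and `δ` precede `θ`, so the bound survives the
removal of the cutoff. -/
theorem IsH2Solution.weighted_bound {ρ a : ℝ} {Q : ℝ → ℝ → ℂ}
    (hQ : IsH2Solution ρ (Icc 0 a) Q) {C : ℝ} :
    ∃ K : ℝ, ∃ δ : ℝ, ∀ θ : ℝ → ℝ, ContDiff ℝ 1 θ → HasCompactSupport θ →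
      (∀ t, |deriv θ t| ≤ C) → ∀ Z ∈ Icc 0 a,
      normL2 (fun t => ((θ t ^ 2 : ℝ) : ℂ) * Q Z t) ^ 2
        ≤ gronwallBound (normL2 (fun t => ((θ t ^ 2 : ℝ) : ℂ) * Q 0 t) ^ 2) K δ Z := by
  obtain ⟨M₀, hM₀, h0⟩ := hQ.1.exists_bound isCompact_Icc (α := 0) (by norm_num)
  obtain ⟨M₂, hM₂, h2⟩ := hQ.1.exists_bound isCompact_Icc (α := 2) le_rfl
  set M := max M₀ M₂ with hM
  -- Twice the constants of `abs_im_integral_weight_le`, because the derivative of a squared norm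
  -- carries a factor 2.
  refine ⟨8 * C, 4 * C * (4 * C ^ 2 + 1) * M ^ 2, fun θ hθ hs hC Z hZ => ?_⟩
  have hw : Continuous fun t => θ t ^ 2 := hθ.continuous.pow 2
  have hws : HasCompactSupport fun t => θ t ^ 2 := hs.comp_left (g := fun x => x ^ 2) (by simp)
  have hmem : ∀ Y ∈ Icc 0 a, MemLp (Q Y) 2 volume := fun Y hY => (hQ.1.1 Y hY).1
  choose! R hR hEq using hQ.2
  have hder := fun Y (hY : Y ∈ Icc 0 a) =>
    hasDerivWithinAt_normL2_sq hmem hY (hR Y hY) hw hws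
  have key := norm_le_gronwallBound_of_norm_deriv_right_le
    (f := fun Y => normL2 (fun t => ((θ t ^ 2 : ℝ) : ℂ) * Q Y t) ^ 2) (a := 0) (b := a)
    (K := 8 * C) (ε := 4 * C * (4 * C ^ 2 + 1) * M ^ 2)
    (fun Y hY => (hder Y hY).continuousWithinAt)
    (fun Y hY => (hder Y (Ico_subset_Icc_self hY)).mono_of_mem_nhdsWithin
      (mem_of_superset (Icc_mem_nhdsGE hY.2) (Icc_subset_Icc_left hY.1)))
    le_rfl (fun Y hY => ?_) Z hZ
  · rw [Real.norm_of_nonneg (sq_nonneg _), Real.norm_of_nonneg (sq_nonneg _), sub_zero] at key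
    exact key
  have hYJ := Ico_subset_Icc_self hY
  have hS := hQ.1.1 Y hYJ
  have hu := hS.1
  have m2 : MemLp (weakDeriv 2 (Q Y)) 2 volume := hS.memLp_weakDeriv le_rfl
  have est := abs_im_integral_weight_le hu (hS.memLp_weakDeriv one_le_two) m2
    (hS.hasWeakDeriv one_le_two) (hS.hasWeakDeriv le_rfl)
    ((congrArg ENNReal.toReal (eLpNorm_congr_ae hS.weakDeriv_zero_ae_eq)).symm.le.trans
      ((h0 Y hYJ).trans (le_max_left _ M₂)))
    ((h2 Y hYJ).trans (le_max_right M₀ _)) hθ hs hC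
  have hint : ∀ {g : ℝ → ℂ}, MemLp g 2 volume → Integrable
      (fun t => (((θ t ^ 2) ^ 2 : ℝ) : ℂ) * (starRingEnd ℂ (Q Y t) * g t)) volume := by
    intro g hg
    have := (memLp_weight_mul hw hws hu).star.integrable_mul (memLp_weight_mul hw hws hg)
    refine this.congr (Eventually.of_forall fun t => ?_)
    simp; ring
  rw [re_integral_weight_eq_neg_im (fun t => (θ t ^ 2) ^ 2) (hint m2) (hint (hR Y hYJ).1)
    (hEq Y hYJ), Real.norm_of_nonneg (sq_nonneg _), Real.norm_eq_abs, abs_mul, abs_neg, abs_two]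
  have e : ∀ t, (θ t ^ 2) ^ 2 = θ t ^ 4 := fun t => by ring
  simp_rw [e]
  linarith

theorem gronwallBound_mono_left (K ε t : ℝ) {x y : ℝ} (hxy : x ≤ y) :
    gronwallBound x K ε t ≤ gronwallBound y K ε t := by
  unfold gronwallBound
  split_ifs <;> gcongr

/-- Since `|θ n t| ≤ |t|`, the initial values are bounded uniformly in `n`, hence so are the norms
at `Z`. At each `t` the weighted functions are eventually equal to `t² Q`, and Fatou's lemma carries
the bound to the limit. -/
theorem IsH2Solution.memLp_sq_mul {ρ a : ℝ} {Q : ℝ → ℝ → ℂ}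
    (hQ : IsH2Solution ρ (Icc 0 a) Q) (h0 : MemLp (fun t : ℝ => (t : ℂ) ^ 2 * Q 0 t) 2 volume)
    {Z : ℝ} (hZ : Z ∈ Icc 0 a) : MemLp (fun t : ℝ => (t : ℂ) ^ 2 * Q Z t) 2 volume := by
  obtain ⟨θ, C, hθ⟩ := exists_weights
  obtain ⟨K, δ, hK⟩ := hQ.weighted_bound (C := C)
  have hm := hQ.1.1 Z hZ
  have hN : ∀ n, MemLp (fun t => ((θ n t ^ 2 : ℝ) : ℂ) * Q Z t) 2 volume := fun n => by
    have hs : HasCompactSupport fun t => θ n t ^ 2 :=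
      (hθ n).2.1.comp_left (g := fun x : ℝ => x ^ 2) (by simp)
    exact memLp_weight_mul ((hθ n).1.continuous.pow 2) hs hm.1
  have hinit : ∀ n, normL2 (fun t => ((θ n t ^ 2 : ℝ) : ℂ) * Q 0 t)
      ≤ normL2 (fun t : ℝ => (t : ℂ) ^ 2 * Q 0 t) := fun n => by
    refine ENNReal.toReal_mono h0.2.ne (eLpNorm_mono fun t => ?_)
    rw [norm_mul, norm_mul, Complex.norm_real, norm_pow, norm_pow, Complex.norm_real]
    gcongr
    exact (hθ n).2.2.2.1 t
  obtain ⟨G, hG⟩ : ∃ G, G = gronwallBound (normL2 (fun t : ℝ => (t : ℂ) ^ 2 * Q 0 t) ^ 2) K δ Z :=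
    ⟨_, rfl⟩
  have hb : ∀ n, eLpNorm (fun t => ((θ n t ^ 2 : ℝ) : ℂ) * Q Z t) 2 volume
      ≤ ENNReal.ofReal (√G) := fun n => by
    rw [← ENNReal.ofReal_toReal (hN n).2.ne]
    refine ENNReal.ofReal_le_ofReal (Real.le_sqrt_of_sq_le ?_)
    rw [hG]
    exact (hK (θ n) (hθ n).1 (hθ n).2.1 (hθ n).2.2.1 Z hZ).trans
      (gronwallBound_mono_left K δ Z (pow_le_pow_left₀ (normL2_nonneg _) (hinit n) 2))
  have hlim : ∀ t : ℝ, Tendsto (fun n => ((θ n t ^ 2 : ℝ) : ℂ) * Q Z t) atTop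
      (𝓝 ((t : ℂ) ^ 2 * Q Z t)) := fun t => by
    refine tendsto_const_nhds.congr' ?_
    filter_upwards [eventually_ge_atTop ⌈|t|⌉₊] with n hn
    rw [(hθ n).2.2.2.2 t (by linarith [Nat.ceil_le.1 hn])]
    push_cast; rfl
  refine ⟨?_, (Lp.eLpNorm_le_of_ae_tendsto (Eventually.of_forall hb) (fun n => (hN n).1)
    (ae_of_all _ hlim)).trans_lt ENNReal.ofReal_lt_top⟩
  exact (Complex.continuous_ofReal.pow 2).aestronglyMeasurable.mul hm.1.1

/-! ### Transfer through the change of variables -/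

theorem newZ_image_Icc {C₂ L : ℝ} (hC₂ : 0 < C₂) (hL : 0 ≤ L) :
    newZ C₂ '' Icc 0 L = Icc 0 (newZ C₂ L) := by
  have hc : Continuous (newZ C₂) := by unfold newZ; fun_prop
  have hm : Monotone (newZ C₂) := by
    intro x y hxy
    unfold newZ
    have : -2 * C₂ * y ≤ -2 * C₂ * x := by nlinarith
    gcongr
  have h0 : newZ C₂ 0 = 0 := by simp [newZ]
  refine Subset.antisymm ?_ ?_
  · rintro _ ⟨z, hz, rfl⟩
    exact ⟨h0 ▸ hm hz.1, hm hz.2⟩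
  · have := intermediate_value_Icc hL hc.continuousOn
    rwa [h0] at this

theorem norm_transformed (C₂ : ℝ) (Q : ℝ → ℝ → ℂ) (z t : ℝ) :
    ‖transformed C₂ Q z t‖ = Real.exp (-(C₂ / 2 * z)) * ‖Q (newZ C₂ z) (newT C₂ z t)‖ := by
  rw [transformed, norm_mul, Complex.norm_exp]
  congr 2
  have : Complex.I * (C₂ / 4 * t ^ 2) - C₂ / 2 * z
      = Complex.I * ((C₂ / 4 * t ^ 2 : ℝ) : ℂ) - ((C₂ / 2 * z : ℝ) : ℂ) := by push_cast; ring
  rw [this, Complex.sub_re, Complex.I_mul_re, Complex.ofReal_im, Complex.ofReal_re]; ring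

theorem memLp_comp_mul_left {f : ℝ → ℂ} (hf : MemLp f 2 volume) {c : ℝ} (hc : c ≠ 0) :
    MemLp (fun t => f (c * t)) 2 volume := by
  have h : MemLp f 2 (Measure.map (c * ·) volume) := by
    rw [Real.map_volume_mul_left hc]
    exact hf.smul_measure ENNReal.ofReal_ne_top
  exact h.comp_of_map (measurable_const_mul c).aemeasurable

end NLSE

theorem corollary3p4p1 (C₂ : ℝ) (hC₂ : 0 < C₂) (ρ : ℝ) (L : ℝ) (hL : 0 < L)
    (Q v : ℝ → ℝ → ℂ)
    (hQ : NLSE.IsH2Solution ρ (NLSE.newZ C₂ '' Set.Icc 0 L) Q)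
    (hv : ∀ z ∈ Set.Icc 0 L, ∀ t : ℝ, v z t = NLSE.transformed C₂ Q z t)
    (hv0 : MemLp (fun t : ℝ => (t : ℂ) ^ 2 * v 0 t) 2 volume)
    (vt : ℝ → ℂ) (hvt : NLSE.HasWeakDeriv 1 (v 0) vt)
    (hvt0 : MemLp (fun t : ℝ => ((|t| : ℝ) : ℂ) * vt t) 2 volume) :
    ∀ z ∈ Set.Icc 0 L, MemLp (fun t : ℝ => (t : ℂ) ^ 2 * v z t) 2 volume := by
  intro z hz
  have hzZ : NLSE.newZ C₂ z ∈ Icc 0 (NLSE.newZ C₂ L) := by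
    rw [← NLSE.newZ_image_Icc hC₂ hL.le]; exact mem_image_of_mem _ hz
  rw [NLSE.newZ_image_Icc hC₂ hL.le] at hQ
  have h00 : (0 : ℝ) ∈ Icc 0 (NLSE.newZ C₂ L) := ⟨le_rfl, hzZ.1.trans hzZ.2⟩
  have hsq : AEStronglyMeasurable (fun t : ℝ => (t : ℂ) ^ 2) volume :=
    (Complex.continuous_ofReal.pow 2).aestronglyMeasurable
  -- At `z = 0` the new variables are `Z = 0`, `T = t`, and the prefactor is unimodular.
  have hQ0 : MemLp (fun t : ℝ => (t : ℂ) ^ 2 * Q 0 t) 2 volume := by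
    refine hv0.congr_norm (hsq.mul (hQ.1.1 0 h00).1.1) (ae_of_all _ fun t => ?_)
    rw [norm_mul, norm_mul, hv 0 ⟨le_rfl, hL.le⟩, NLSE.norm_transformed]
    simp [NLSE.newZ, NLSE.newT]
  set c := Real.exp (-C₂ * z) with hc
  have hc0 : c ≠ 0 := (Real.exp_pos _).ne'
  have h := NLSE.memLp_comp_mul_left (hQ.memLp_sq_mul hQ0 hzZ) hc0
  have hmeas : AEStronglyMeasurable (v z) volume := by
    rw [funext (hv z hz)]
    refine Continuous.aestronglyMeasurable ?_ |>.mul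
      (NLSE.memLp_comp_mul_left (hQ.1.1 _ hzZ).1 hc0).1
    fun_prop
  -- With `T = c t` one has `t² = c⁻² T²`; the exponential is the modulus of the prefactor of `Q`.
  refine h.of_le_mul (c := (c ^ 2)⁻¹ * Real.exp (-(C₂ / 2 * z))) (hsq.mul hmeas)
    (ae_of_all _ fun t => le_of_eq ?_)
  rw [norm_mul, norm_mul, hv z hz, NLSE.norm_transformed, norm_pow, norm_pow, Complex.norm_real,
    Complex.norm_real, norm_mul, Real.norm_of_nonneg (Real.exp_pos _).le, NLSE.newT, ← hc]
  field_simp
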